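/- Theorem 7.1 (Enflo). Let $X$ be a super-reflexive real Banach space, i.e. every Banach space $Y$ that is finitely representable in $X$ is reflexive. ($Y$ is finitely representable in $X$ if for every finite-dimensional subspace $F\subset Y$ and every $\varepsilon>0$ there is a linear map $T:F\to X$ with $\|y\|\le\|Ty\|\le(1+\varepsilon)\|y\|$ for all $y\in F$.) Then $X$ has an equivalent uniformly convex norm: there are a norm $|\!|\!|\cdot|\!|\!|$ on $X$ and constants $c,C>0$ with $c\|x\|\le|\!|\!|x|\!|\!|\le C\|x\|$ for all $x\in X$, such that for every $\varepsilon>0$ there is $\delta>0$ with $|\!|\!|x+y|\!|\!|\le 2-\delta$ whenever $|\!|\!|x|\!|\!|=|\!|\!|y|\!|\!|=1$ and $|\!|\!|x-y|\!|\!|\ge\varepsilon$. -/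

import Mathlib

universe u v w

/-- A Banach space is reflexive if its canonical embedding into its bidual is onto. -/
def IsReflexiveSpace (Y : Type v) [NormedAddCommGroup Y] [NormedSpace ℝ Y] : Prop :=
  Function.Surjective (NormedSpace.inclusionInDoubleDual ℝ Y)

/-- `Y` is finitely representable in `X`: every finite-dimensional subspace of `Y` embeds
`(1 + ε)`-isomorphically into `X`, for every `ε > 0`. (The isomorphism onto its image is scaled
so that its inverse has norm at most one; in particular it is injective.) -/
def FinitelyRepresentable (Y : Type v) [NormedAddCommGroup Y] [NormedSpace ℝ Y]
    (X : Type w) [NormedAddCommGroup X] [NormedSpace ℝ X] : Prop :=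
  ∀ F : Submodule ℝ Y, FiniteDimensional ℝ F → ∀ ε : ℝ, 0 < ε →
    ∃ T : F →ₗ[ℝ] X, ∀ y : F, ‖y‖ ≤ ‖T y‖ ∧ ‖T y‖ ≤ (1 + ε) * ‖y‖

/-- `X` is super-reflexive: every Banach space that is finitely representable in `X` is
reflexive. (Testing in the universe of `X` is enough: a non-reflexive Banach space has a
separable non-reflexive closed subspace, which has a copy in every universe.) -/
def SuperReflexive (X : Type u) [NormedAddCommGroup X] [NormedSpace ℝ X] : Prop :=
  ∀ (Y : Type u) [NormedAddCommGroup Y] [NormedSpace ℝ Y] [CompleteSpace Y],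
    FinitelyRepresentable Y X → IsReflexiveSpace Y

/-- `p` is a norm on `X` equivalent to the given one. (The lower bound makes the seminorm `p`
a norm.) -/
def IsEquivalentNorm {X : Type u} [NormedAddCommGroup X] [NormedSpace ℝ X]
    (p : Seminorm ℝ X) : Prop :=
  ∃ c C : ℝ, 0 < c ∧ 0 < C ∧ ∀ x : X, c * ‖x‖ ≤ p x ∧ p x ≤ C * ‖x‖

/-- `p` is uniformly convex: the space `X`, normed by `p` instead of its given norm, is
uniformly convex. -/
def IsUniformlyConvexNorm {X : Type u} [NormedAddCommGroup X] [NormedSpace ℝ X]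
    (p : Seminorm ℝ X) : Prop :=
  @UniformConvexSpace X p.toAddGroupSeminorm.toSeminormedAddCommGroup

/-- The definition of a uniformly convex norm, written out. -/
theorem isUniformlyConvexNorm_iff {X : Type u} [NormedAddCommGroup X] [NormedSpace ℝ X]
    (p : Seminorm ℝ X) :
    IsUniformlyConvexNorm p ↔ ∀ ε : ℝ, 0 < ε → ∃ δ : ℝ, 0 < δ ∧ ∀ x y : X,
      p x = 1 → p y = 1 → ε ≤ p (x - y) → p (x + y) ≤ 2 - δ := by
  constructor
  · intro h ε hε
    obtain ⟨δ, hδ, H⟩ := h.uniform_convex hε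
    exact ⟨δ, hδ, fun x y hx hy hxy => H hx hy hxy⟩
  · intro h
    refine @UniformConvexSpace.mk X p.toAddGroupSeminorm.toSeminormedAddCommGroup ?_
    intro ε hε
    obtain ⟨δ, hδ, H⟩ := h ε hε
    exact ⟨δ, hδ, fun x hx y hy hxy => H x y hx hy hxy⟩

/-! Suppose `X` had dyadic `ε`-separated trees of every height in a fixed ball. In the ultrapower,
which is finitely representable in `X`, their limits form a bounded set whose points are all
midpoints of `ε`-separated pairs. Reflexive spaces contain no such set: a countable bounded set has
slices of small diameter, and a point deep in a slice has both ends of its pair in that slice. Hence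
super-reflexivity bounds the heights of trees (`exists_not_hasTree`).

Splitting a vector repeatedly into separated halves of equal norm, with little growth of the total
norm, would build such a tree. So for some `n`, `n` splittings multiply the total by at least `1 +
δ` (`exists_le_of_dyadicPart`). Now measure a vector by the least total over its splittings, divided
by a weight that increases with depth but stays below `1 + δ`. Only depths below `n` matter, and
joining two separated vectors of equal norm raises the depth, which yields a fixed gain
(`discountedNorm_add_le`). The gauge of the convex hull is an equivalent norm, and a jointly convex
penalty carries the gain over to the hull (`add_mul_norm_sub_le_of_mem_convexHull`). This settles
one scale of separation; a geometric series of such norms settles all of them. -/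

namespace Enflo

open Filter Topology Set

/-! ### Small slices of bounded sets in reflexive spaces -/

section Dentability

variable {Y : Type u} [NormedAddCommGroup Y] [NormedSpace ℝ Y]

/-- The weak-star closed convex hull of (the canonical image of) `T` in the bidual. -/
def bidualHull (T : Set Y) : Set (WeakDual ℝ (StrongDual ℝ Y)) :=
  {z | ∀ (f : StrongDual ℝ Y) (a : ℝ), (∀ t ∈ T, f t ≤ a) → z f ≤ a}

/-- Every functional is at least as large on `E` as it is on `T`. -/
def Dominates (E : Set (WeakDual ℝ (StrongDual ℝ Y))) (T : Set Y) : Prop :=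
  ∀ (f : StrongDual ℝ Y) (a : ℝ), (∀ z ∈ E, z f ≤ a) → ∀ t ∈ T, f t ≤ a

theorem isClosed_bidualHull (T : Set Y) : IsClosed (bidualHull T) := by
  simp only [bidualHull, ofPred_forall]
  exact isClosed_iInter fun f => isClosed_iInter fun a => isClosed_iInter fun _ =>
    isClosed_le (WeakDual.eval_continuous f) continuous_const

theorem isCompact_bidualHull {T : Set Y} {R : ℝ} (hT : ∀ t ∈ T, ‖t‖ ≤ R) (hR : 0 ≤ R) :
    IsCompact (bidualHull T) := by
  refine (WeakDual.isCompact_closedBall (𝕜 := ℝ) (0 : StrongDual ℝ (StrongDual ℝ Y))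
    R).of_isClosed_subset (isClosed_bidualHull T) fun z hz => ?_
  rw [mem_preimage, mem_closedBall_zero_iff]
  refine ContinuousLinearMap.opNorm_le_bound _ hR fun f => ?_
  have key : ∀ g : StrongDual ℝ Y, z g ≤ R * ‖g‖ := fun g => hz g _ fun t ht =>
    (le_abs_self _).trans ((g.le_opNorm t).trans
      (by rw [mul_comm]; exact mul_le_mul_of_nonneg_right (hT t ht) (norm_nonneg g)))
  have h1 := key f
  have h2 := key (-f)
  rw [norm_neg, map_neg] at h2
  exact abs_le.2 ⟨by change -_ ≤ z f; linarith, h1⟩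

theorem dominates_bidualHull (T : Set Y) : Dominates (bidualHull T) T := by
  intro f a h t ht
  exact h (NormedSpace.inclusionInDoubleDual ℝ Y t : StrongDual ℝ (StrongDual ℝ Y))
    fun g b hb => hb t ht

/-- A minimal closed subset of the hull of `T` which still dominates `T`. -/
theorem exists_minimal_dominates {T : Set Y} {R : ℝ} (hT : ∀ t ∈ T, ‖t‖ ≤ R) (hR : 0 ≤ R) :
    ∃ E, Minimal (fun E => IsClosed E ∧ E ⊆ bidualHull T ∧ Dominates E T) E := by
  refine zorn_superset {E | IsClosed E ∧ E ⊆ bidualHull T ∧ Dominates E T} fun c hc hchain => ?_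
  rcases c.eq_empty_or_nonempty with rfl | hne
  · exact ⟨_, ⟨isClosed_bidualHull T, Subset.rfl, dominates_bidualHull T⟩, by simp⟩
  obtain ⟨E₀, hE₀⟩ := hne
  refine ⟨⋂₀ c, ⟨isClosed_sInter fun E hE => (hc hE).1,
    (sInter_subset_of_mem hE₀).trans (hc hE₀).2.1, ?_⟩, fun E hE => sInter_subset_of_mem hE⟩
  intro f a h t ht
  by_contra! hlt
  obtain ⟨b, hab, hbt⟩ := exists_between hlt
  have hcl : IsClosed {z : WeakDual ℝ (StrongDual ℝ Y) | b ≤ z f} :=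
    isClosed_le continuous_const (WeakDual.eval_continuous f)
  have hK := isCompact_bidualHull hT hR
  -- Each slice is nonempty, since `E` dominates `T` and `b < f t`; compactness gives a point common
  -- to the chain.
  have hnon : (⋂₀ ((fun E => E ∩ {z | b ≤ z f}) '' c)).Nonempty := by
    have : Nonempty ↑((fun E => E ∩ {z : WeakDual ℝ (StrongDual ℝ Y) | b ≤ z f}) '' c) :=
      ⟨⟨_, mem_image_of_mem _ hE₀⟩⟩
    refine IsCompact.nonempty_sInter_of_directed_nonempty_isCompact_isClosed ?_ ?_ ?_ ?_
    · rintro _ ⟨E, hE, rfl⟩ _ ⟨F, hF, rfl⟩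
      rcases hchain.total hE hF with h' | h'
      · exact ⟨_, mem_image_of_mem _ hE, Subset.rfl, inter_subset_inter_left _ h'⟩
      · exact ⟨_, mem_image_of_mem _ hF, inter_subset_inter_left _ h', Subset.rfl⟩
    · rintro _ ⟨E, hE, rfl⟩
      by_contra hemp
      refine hbt.not_ge ((hc hE).2.2 f b (fun z hz => ?_) t ht)
      by_contra! hz'
      exact hemp ⟨z, hz, hz'.le⟩
    · rintro _ ⟨E, hE, rfl⟩
      exact hK.of_isClosed_subset ((hc hE).1.inter hcl) (inter_subset_left.trans (hc hE).2.1)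
    · rintro _ ⟨E, hE, rfl⟩
      exact (hc hE).1.inter hcl
  obtain ⟨z, hz⟩ := hnon
  have h1 := h z fun E hE => (hz _ (mem_image_of_mem _ hE)).1
  exact (hab.trans_le (hz _ (mem_image_of_mem _ hE₀)).2).not_ge h1

/-- In a reflexive space the bidual hull of `T` consists of points of the closed span of `T`. -/
theorem exists_mem_closure_span_of_mem_bidualHull (hY : IsReflexiveSpace Y) {T : Set Y}
    {z : WeakDual ℝ (StrongDual ℝ Y)} (hz : z ∈ bidualHull T) :
    ∃ y ∈ closure (Submodule.span ℝ T : Set Y), ∀ f : StrongDual ℝ Y, z f = f y := by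
  obtain ⟨y, hy⟩ := hY (WeakDual.toStrongDual z)
  have hzf : ∀ f : StrongDual ℝ Y, z f = f y := fun f => by
    change (WeakDual.toStrongDual z) f = f y
    rw [← hy]; rfl
  refine ⟨y, ?_, hzf⟩
  by_contra hmem
  obtain ⟨f, u, hu, hfu⟩ := geometric_hahn_banach_closed_point
    (Submodule.span ℝ T).convex.closure isClosed_closure hmem
  have := hz f u fun t ht => (hu t (subset_closure (Submodule.subset_span ht))).le
  rw [hzf] at this
  exact absurd this (not_le.2 hfu)

/-- A countable bounded set in a reflexive space has a slice of small diameter. -/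
theorem exists_slice_subset_closedBall (hY : IsReflexiveSpace Y) {T : Set Y} (hc : T.Countable)
    (hne : T.Nonempty) {R : ℝ} (hT : ∀ t ∈ T, ‖t‖ ≤ R) {r : ℝ} (hr : 0 < r) :
    ∃ (f : StrongDual ℝ Y) (M η : ℝ) (c : Y), 0 < η ∧ (∀ t ∈ T, f t ≤ M) ∧
      (∃ t ∈ T, M - η < f t) ∧ ∀ t ∈ T, M - 2 * η < f t → ‖t - c‖ ≤ 2 * r := by
  obtain ⟨t₀, ht₀⟩ := hne
  have hR : 0 ≤ R := (norm_nonneg t₀).trans (hT t₀ ht₀)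
  obtain ⟨E, ⟨hEcl, hEsub, hEdom⟩, hEmin⟩ := exists_minimal_dominates hT hR
  have hEcomp : IsCompact E := (isCompact_bidualHull hT hR).of_isClosed_subset hEcl hEsub
  have hEne : E.Nonempty := by
    by_contra hemp
    rw [not_nonempty_iff_eq_empty] at hemp
    subst hemp
    have := hEdom 0 (-1) (by simp) t₀ ht₀
    norm_num at this
  obtain ⟨C, hCc, hC⟩ := (hc.isSeparable.span (R := ℝ)).closure
  have : CompactSpace E := isCompact_iff_compactSpace.1 hEcomp
  have : Nonempty E := hEne.to_subtype
  have : Countable C := hCc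
  -- `B c` is the part of `E` within `r` of `c`, written with functionals so that it is weak-star
  -- closed. Countably many cover the compact `E`, so by Baire one has interior.
  let B : C → Set E := fun c => {z | ∀ f : StrongDual ℝ Y, ‖f‖ ≤ 1 → z.1 f ≤ f c + r}
  have hBcl : ∀ c, IsClosed (B c) := by
    intro c
    simp only [B, ofPred_forall]
    exact isClosed_iInter fun f => isClosed_iInter fun _ =>
      isClosed_le ((WeakDual.eval_continuous f).comp continuous_subtype_val) continuous_const
  have hBcov : ⋃ c, B c = univ := by
    refine eq_univ_of_forall fun z => ?_
    obtain ⟨y, hy, hzy⟩ := exists_mem_closure_span_of_mem_bidualHull hY (hEsub z.2)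
    obtain ⟨c, hcC, hcy⟩ := Metric.mem_closure_iff.1 (hC hy) r hr
    refine mem_iUnion.2 ⟨⟨c, hcC⟩, fun f hf => ?_⟩
    rw [hzy]
    have h1 : f (y - c) ≤ ‖f‖ * ‖y - c‖ := (le_abs_self _).trans (f.le_opNorm _)
    rw [dist_eq_norm] at hcy
    rw [map_sub] at h1
    nlinarith [norm_nonneg (y - c)]
  obtain ⟨⟨c, hcC⟩, z₀, hz₀⟩ := nonempty_interior_of_iUnion_of_closed hBcl hBcov
  obtain ⟨U, hUB, hUo, hzU⟩ := mem_interior.1 hz₀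
  obtain ⟨W, hWo, rfl⟩ := isOpen_induced_iff.1 hUo
  have hnot : ¬ Dominates (E \ W) T := fun hdom =>
    (hEmin ⟨hEcl.sdiff hWo, sdiff_subset.trans hEsub, hdom⟩ sdiff_subset z₀.2).2 hzU
  simp only [Dominates, not_forall, not_le] at hnot
  obtain ⟨f, a, hfa, t₁, ht₁, hat₁⟩ := hnot
  have hbdd : BddAbove (f '' T) := by
    refine ⟨‖f‖ * R, ?_⟩
    rintro _ ⟨t, ht, rfl⟩
    exact (le_abs_self _).trans ((f.le_opNorm t).trans
      (mul_le_mul_of_nonneg_left (hT t ht) (norm_nonneg f)))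
  set M := sSup (f '' T) with hM
  have hTM : ∀ t ∈ T, f t ≤ M := fun t ht => le_csSup hbdd (mem_image_of_mem f ht)
  have hd : 0 < M - a := by linarith [hTM t₁ ht₁]
  -- `K` is chosen so that `D` contains `E`: on `W` the distance to `c` is at most `r`, and off `W`
  -- the drop `K * (M - a)` pays for a distance up to `R + ‖c‖`. Domination then puts `T` inside
  -- `D`.
  set K := (R + ‖c‖) / (M - a) with hK
  have hK0 : 0 ≤ K := by positivity
  let D : Set Y := {y | ‖y - c‖ + K * f y ≤ r + K * M}
  have hDconv : Convex ℝ D := by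
    have h1 : ConvexOn ℝ univ fun y : Y => ‖y - c‖ := by
      simpa [dist_eq_norm] using convexOn_univ_dist (c : Y)
    have h2 : ConvexOn ℝ univ fun y : Y => K * f y :=
      ((f.toLinearMap.convexOn convex_univ).smul hK0)
    simpa [D] using (h1.add h2).convex_le (r + K * M)
  have hDcl : IsClosed D := isClosed_le (by fun_prop) continuous_const
  have hTD : T ⊆ D := by
    intro t ht
    by_contra hmem
    obtain ⟨g, u, hu, hgu⟩ := geometric_hahn_banach_closed_point hDconv hDcl hmem
    refine hgu.not_ge (hEdom g u (fun z hz => ?_) t ht)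
    obtain ⟨y, hy, hzy⟩ := exists_mem_closure_span_of_mem_bidualHull hY (hEsub hz)
    have hball : ∀ s : ℝ, (∀ g : StrongDual ℝ Y, ‖g‖ ≤ 1 → g (y - c) ≤ s) →
        ‖y - c‖ ≤ s := fun s h => by
      obtain ⟨g, hg, hgy⟩ := exists_dual_vector'' ℝ (y - c)
      have := h g hg
      rw [hgy] at this
      simpa using this
    rw [hzy]
    refine (hu y ?_).le
    change ‖y - c‖ + K * f y ≤ r + K * M
    by_cases hzW : z ∈ W
    · have h1 : ‖y - c‖ ≤ r := hball r fun g hg => by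
        have := hUB (show (⟨z, hz⟩ : E) ∈ Subtype.val ⁻¹' W from hzW) g hg
        rw [hzy] at this
        rw [map_sub]; linarith
      have h2 : f y ≤ M := by rw [← hzy]; exact hEsub hz f M hTM
      nlinarith
    · have h1 : ‖y - c‖ ≤ R + ‖c‖ := hball _ fun g hg => by
        have h3 : g y ≤ R := by
          rw [← hzy]
          refine hEsub hz g R fun t ht => (le_abs_self _).trans ((g.le_opNorm t).trans ?_)
          nlinarith [hT t ht, norm_nonneg t]
        have h4 : -g c ≤ ‖c‖ := (neg_le_abs _).trans ((g.le_opNorm c).trans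
          (by nlinarith [norm_nonneg c]))
        rw [map_sub]; linarith
      have h2 : f y ≤ a := by rw [← hzy]; exact hfa z ⟨hz, hzW⟩
      have h3 : K * (M - a) = R + ‖c‖ := div_mul_cancel₀ _ hd.ne'
      nlinarith
  obtain ⟨_, ⟨t₂, ht₂, rfl⟩, hlt⟩ := exists_lt_of_lt_csSup (Set.Nonempty.image f ⟨t₀, ht₀⟩)
    (show M - r / (2 * (K + 1)) < sSup (f '' T) by
      rw [← hM]; linarith [show 0 < r / (2 * (K + 1)) by positivity])
  refine ⟨f, M, r / (2 * (K + 1)), c, by positivity, hTM, ⟨t₂, ht₂, hlt⟩, fun t ht hft => ?_⟩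
  have h1 : ‖t - c‖ + K * f t ≤ r + K * M := hTD ht
  have h2 : 2 * (r / (2 * (K + 1))) * (K + 1) = r := by field_simp
  have h3 : 0 < r / (2 * (K + 1)) := by positivity
  nlinarith

/-- A reflexive space contains no bounded countable set all of whose points are midpoints of
`ε`-separated pairs of the set. -/
theorem not_isReflexiveSpace_of_midpoints {T : Set Y} (hc : T.Countable) (hne : T.Nonempty)
    {R ε : ℝ} (hT : ∀ t ∈ T, ‖t‖ ≤ R) (hε : 0 < ε)
    (hmid : ∀ t ∈ T, ∃ d, ε ≤ ‖d‖ ∧ t + d ∈ T ∧ t - d ∈ T) : ¬ IsReflexiveSpace Y := by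
  intro hY
  obtain ⟨f, M, η, c, hη, hM, ⟨t, ht, htM⟩, hball⟩ :=
    exists_slice_subset_closedBall hY hc hne hT (show 0 < ε / 4 by positivity)
  obtain ⟨d, hd, hp, hm⟩ := hmid t ht
  have h1 := hM _ hp
  have h2 := hM _ hm
  -- The values of `f` at `t ± d` average to more than `M - η` and are at most `M`, so both exceed
  -- `M - 2 * η`.
  have h3 := hball _ hp (by rw [map_add]; rw [map_sub] at h2; linarith)
  have h4 := hball _ hm (by rw [map_sub]; rw [map_add] at h1; linarith)
  have h5 : ‖(2 : ℝ) • d‖ ≤ ‖t + d - c‖ + ‖t - d - c‖ := by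
    have : (2 : ℝ) • d = (t + d - c) - (t - d - c) := by module
    rw [this]; exact norm_sub_le _ _
  rw [norm_smul] at h5
  norm_num at h5
  have h7 : 2 * ‖d‖ ≤ ε := by linarith
  linarith

end Dentability

end Enflo

namespace Enflo

open Filter Topology Set BoundedContinuousFunction

/-! ### Ultrapowers and finite representability -/

section Ultrapower

variable (X : Type u) [NormedAddCommGroup X] [NormedSpace ℝ X]

/-- The bounded sequences that tend to zero along the hyperfilter. -/
def ultraNull : Submodule ℝ (ℕ →ᵇ X) where
  carrier := {x | Tendsto (fun n => ‖x n‖) (hyperfilter ℕ : Filter ℕ) (𝓝 0)}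
  zero_mem' := by simp
  add_mem' := by
    intro x y hx hy
    refine squeeze_zero (fun n => norm_nonneg _) (fun n => norm_add_le (x n) (y n)) ?_
    simpa using Tendsto.add hx hy
  smul_mem' := by
    intro c x hx
    have := Tendsto.const_mul ‖c‖ hx
    simpa [norm_smul] using this

variable {X}

theorem mem_ultraNull {x : ℕ →ᵇ X} :
    x ∈ ultraNull X ↔ Tendsto (fun n => ‖x n‖) (hyperfilter ℕ : Filter ℕ) (𝓝 0) := Iff.rfl

instance isClosed_ultraNull : IsClosed (ultraNull X : Set (ℕ →ᵇ X)) := by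
  refine isClosed_of_closure_subset fun x hx => ?_
  refine mem_ultraNull.2 (tendsto_order.2 ⟨fun a ha => Eventually.of_forall fun n =>
    ha.trans_le (norm_nonneg _), fun a ha => ?_⟩)
  obtain ⟨y, hy, hxy⟩ := Metric.mem_closure_iff.1 hx (a / 2) (by positivity)
  filter_upwards [(tendsto_order.1 (mem_ultraNull.1 hy)).2 (a / 2) (by positivity)] with n hn
  have h1 : ‖x n - y n‖ ≤ dist x y := by rw [dist_eq_norm]; exact (x - y).norm_coe_le_norm n
  linarith [norm_le_norm_add_norm_sub' (x n) (y n)]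

variable (X)

/-- The ultrapower of `X` along the hyperfilter on `ℕ`. -/
abbrev Ultrapower : Type u := (ℕ →ᵇ X) ⧸ ultraNull X

variable {X}

/-- Changing a representative off a set of the ultrafilter does not change its class, so coordinates
that are too large can be set to zero. -/
theorem tendsto_norm_ultrapower (x : ℕ →ᵇ X) :
    Tendsto (fun n => ‖x n‖) (hyperfilter ℕ : Filter ℕ)
      (𝓝 ‖(Submodule.Quotient.mk x : Ultrapower X)‖) := by
  classical
  refine tendsto_order.2 ⟨fun a ha => ?_, fun a ha => ?_⟩
  · by_contra hne
    rw [← Ultrafilter.eventually_not] at hne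
    let y : ℕ →ᵇ X := BoundedContinuousFunction.ofNormedAddCommGroupDiscrete
      (fun n => if a < ‖x n‖ then 0 else x n) ‖x‖ fun n => by
        split_ifs
        · simp
        · exact x.norm_coe_le_norm n
    have hy : ∀ n, y n = if a < ‖x n‖ then 0 else x n := fun n => rfl
    have hxy : (Submodule.Quotient.mk x : Ultrapower X) = Submodule.Quotient.mk y := by
      rw [Submodule.Quotient.eq, mem_ultraNull]
      refine tendsto_const_nhds.congr' ?_
      filter_upwards [hne] with n hn
      simp [hy, hn]
    have ha0 : 0 ≤ a := by
      obtain ⟨n, hn⟩ := hne.exists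
      exact (norm_nonneg _).trans (not_lt.1 hn)
    have hya : ‖y‖ ≤ a := by
      refine (BoundedContinuousFunction.norm_le ha0).2 fun n => ?_
      rw [hy]
      split_ifs with h
      · simpa using ha0
      · exact not_lt.1 h
    rw [hxy] at ha
    exact ((Submodule.Quotient.norm_mk_le _ y).trans hya).not_gt ha
  · obtain ⟨y, hyx, hy⟩ := Submodule.Quotient.norm_mk_lt
      (Submodule.Quotient.mk x : Ultrapower X) (sub_pos.2 ha)
    have hnull : Tendsto (fun n => ‖(x - y) n‖) (hyperfilter ℕ : Filter ℕ) (𝓝 0) :=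
      mem_ultraNull.1 ((Submodule.Quotient.eq _).1 hyx.symm)
    have hya : ‖y‖ < a := by linarith
    filter_upwards [(tendsto_order.1 hnull).2 (a - ‖y‖) (by linarith)] with n hn
    have h1 := y.norm_coe_le_norm n
    have h2 := norm_le_norm_add_norm_sub' (x n) (y n)
    rw [BoundedContinuousFunction.sub_apply] at hn
    linarith

/-- Lift `F` linearly to bounded sequences. A finite net of the compact unit sphere makes the
convergence of norms uniform, so a single coordinate is almost isometric on `F`. -/
theorem finitelyRepresentable_ultrapower : FinitelyRepresentable (Ultrapower X) X := by
  intro F hF ε hε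
  obtain ⟨g, hg⟩ := LinearMap.exists_rightInverse_of_surjective (ultraNull X).mkQ
    (Submodule.range_mkQ _)
  let S : F →L[ℝ] (ℕ →ᵇ X) := LinearMap.toContinuousLinearMap (g ∘ₗ F.subtype)
  have hS : ∀ y : F, (Submodule.Quotient.mk (S y) : Ultrapower X) = y := fun y =>
    LinearMap.congr_fun hg (y : Ultrapower X)
  have hlim : ∀ y : F, Tendsto (fun n => ‖S y n‖) (hyperfilter ℕ : Filter ℕ) (𝓝 ‖y‖) := by
    intro y
    have := tendsto_norm_ultrapower (S y)
    rwa [hS] at this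
  -- This solves `(1 + θ) / (1 - θ) = 1 + ε`.
  set θ := ε / (2 + ε) with hθ
  have hθ0 : 0 < θ := by positivity
  have hθ1 : 0 < 1 - θ := by
    rw [hθ, one_sub_div (by positivity)]; exact div_pos (by linarith) (by linarith)
  have hK0 : 0 ≤ ‖S‖ := norm_nonneg S
  obtain ⟨s, hs, hsfin, hcov⟩ := (isCompact_sphere (0 : F) 1).finite_cover_balls
    (show 0 < θ / (2 * (‖S‖ + 1)) by positivity)
  have hev : ∀ᶠ n in (hyperfilter ℕ : Filter ℕ), ∀ y ∈ s,
      |‖S y n‖ - 1| < θ / 2 := by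
    refine (hsfin.eventually_all).2 fun y hy => ?_
    have h1 : ‖y‖ = 1 := by simpa using hs hy
    have := Metric.tendsto_nhds.1 (hlim y) (θ / 2) (by positivity)
    rw [h1] at this
    simpa [Real.dist_eq] using this
  obtain ⟨n, hn⟩ := hev.exists
  have hsph : ∀ y : F, ‖y‖ = 1 → |‖S y n‖ - 1| ≤ θ := by
    intro y hy
    obtain ⟨z, hz, hyz⟩ : ∃ z ∈ s, dist y z < θ / (2 * (‖S‖ + 1)) := by
      simpa using hcov (show y ∈ Metric.sphere (0 : F) 1 by simpa using hy)
    have h1 := hn z hz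
    have h2 : |‖S y n‖ - ‖S z n‖| ≤ θ / 2 := by
      refine (abs_norm_sub_norm_le _ _).trans ?_
      have h3 : ‖S y n - S z n‖ ≤ ‖S‖ * ‖y - z‖ := by
        have := (S (y - z)).norm_coe_le_norm n
        rw [map_sub] at this
        exact this.trans (by rw [← map_sub]; exact S.le_opNorm _)
      rw [dist_eq_norm] at hyz
      have h4 : θ / (2 * (‖S‖ + 1)) * (‖S‖ + 1) = θ / 2 := by field_simp
      nlinarith [norm_nonneg (y - z)]
    have h5 : ‖S y n‖ - 1 = (‖S y n‖ - ‖S z n‖) + (‖S z n‖ - 1) := by ring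
    rw [h5]
    refine (abs_add_le _ _).trans ?_
    linarith
  have hall : ∀ y : F, (1 - θ) * ‖y‖ ≤ ‖S y n‖ ∧ ‖S y n‖ ≤ (1 + θ) * ‖y‖ := by
    intro y
    rcases eq_or_ne y 0 with rfl | hy
    · simp
    have hy0 : 0 < ‖y‖ := norm_pos_iff.2 hy
    have h1 := hsph (‖y‖⁻¹ • y) (by
      rw [norm_smul, norm_inv, norm_norm, inv_mul_cancel₀ hy0.ne'])
    have h2 : ‖S (‖y‖⁻¹ • y) n‖ = ‖y‖⁻¹ * ‖S y n‖ := by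
      rw [map_smul, BoundedContinuousFunction.smul_apply, norm_smul]; simp
    rw [h2, abs_le] at h1
    have h3 : ‖y‖ * (‖y‖⁻¹ * ‖S y n‖) = ‖S y n‖ := by field_simp
    constructor <;> nlinarith
  let T : F →ₗ[ℝ] X :=
    { toFun := fun y => (1 - θ)⁻¹ • S y n
      map_add' := fun y z => by simp
      map_smul' := fun c y => by simp [smul_comm c] }
  refine ⟨T, fun y => ?_⟩
  have hT : ‖T y‖ = (1 - θ)⁻¹ * ‖S y n‖ := by
    change ‖(1 - θ)⁻¹ • S y n‖ = _
    rw [norm_smul, Real.norm_of_nonneg (by positivity)]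
  have h1 : (1 - θ)⁻¹ * (1 + θ) = 1 + ε := by
    rw [hθ, one_sub_div (by positivity)]; field_simp; ring
  obtain ⟨h2, h3⟩ := hall y
  rw [hT, ← h1, mul_assoc]
  refine ⟨?_, mul_le_mul_of_nonneg_left h3 (by positivity)⟩
  calc ‖y‖ = (1 - θ)⁻¹ * ((1 - θ) * ‖y‖) := by field_simp
    _ ≤ _ := mul_le_mul_of_nonneg_left h2 (by positivity)

end Ultrapower

/-! ### Finite trees and their limits in the ultrapower -/

section Tree

/-- `x` is the root of a dyadic tree of height `n` in the ball of radius `R` such that each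
node is the midpoint of its two children, which lie at distance at least `ε` from it. -/
def HasTree {X : Type u} [NormedAddCommGroup X] (ε R : ℝ) : ℕ → X → Prop
  | 0, x => ‖x‖ ≤ R
  | n + 1, x => ‖x‖ ≤ R ∧ ∃ d, ε ≤ ‖d‖ ∧ HasTree ε R n (x + d) ∧ HasTree ε R n (x - d)

theorem HasTree.norm_le {X : Type u} [NormedAddCommGroup X] {ε R : ℝ} {n : ℕ} {x : X}
    (h : HasTree ε R n x) : ‖x‖ ≤ R := by
  cases n with
  | zero => exact h
  | succ n => exact h.1

variable {X : Type u} [NormedAddCommGroup X] [NormedSpace ℝ X]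

/-- The points of the ultrapower represented by roots of trees whose heights are unbounded. -/
def treePoints (X : Type u) [NormedAddCommGroup X] [NormedSpace ℝ X] (ε R : ℝ) :
    Set (Ultrapower X) :=
  {y | ∃ (k : ℕ → ℕ) (x : ℕ →ᵇ X), Tendsto k (hyperfilter ℕ : Filter ℕ) atTop ∧
    (∀ᶠ n in (hyperfilter ℕ : Filter ℕ), HasTree ε R (k n) (x n)) ∧ Submodule.Quotient.mk x = y}

theorem norm_le_of_mem_treePoints {ε R : ℝ} {y : Ultrapower X} (hy : y ∈ treePoints X ε R) :
    ‖y‖ ≤ R := by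
  obtain ⟨k, x, -, hx, rfl⟩ := hy
  exact le_of_tendsto (tendsto_norm_ultrapower x) (hx.mono fun n hn => hn.norm_le)

theorem treePoints_nonempty {ε R : ℝ} (h : ∀ n, ∃ x : X, HasTree ε R n x) :
    (treePoints X ε R).Nonempty := by
  choose x hx using h
  refine ⟨_, id, BoundedContinuousFunction.ofNormedAddCommGroupDiscrete x R
    fun n => (hx n).norm_le, ?_, Eventually.of_forall fun n => hx n, rfl⟩
  rw [← Nat.cofinite_eq_atTop]
  exact tendsto_id.mono_left (hyperfilter_le_cofinite)

theorem exists_midpoint_of_mem_treePoints {ε R : ℝ} {y : Ultrapower X}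
    (hy : y ∈ treePoints X ε R) :
    ∃ d, ε ≤ ‖d‖ ∧ y + d ∈ treePoints X ε R ∧ y - d ∈ treePoints X ε R := by
  classical
  obtain ⟨k, x, hk, hx, rfl⟩ := hy
  have hev : ∀ᶠ n in (hyperfilter ℕ : Filter ℕ), ∃ d : X, ε ≤ ‖d‖ ∧
      HasTree ε R (k n - 1) (x n + d) ∧ HasTree ε R (k n - 1) (x n - d) := by
    filter_upwards [hx, hk.eventually_ge_atTop 1] with n hn h1
    obtain ⟨m, hm⟩ := Nat.exists_eq_add_of_le' h1
    rw [hm] at hn ⊢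
    exact hn.2
  let P : ℕ → X → Prop := fun n d => ε ≤ ‖d‖ ∧
      HasTree ε R (k n - 1) (x n + d) ∧ HasTree ε R (k n - 1) (x n - d)
  have hP : ∀ n d, P n d → ‖d‖ ≤ R + ‖x‖ := fun n d hd => by
    have h1 := hd.2.1.norm_le
    have h2 := x.norm_coe_le_norm n
    have h3 : ‖d‖ ≤ ‖x n + d‖ + ‖x n‖ := by
      simpa using norm_sub_le (x n + d) (x n)
    linarith
  obtain ⟨n₀, d₀, hd₀⟩ := hev.exists
  have hR : 0 ≤ R + ‖x‖ := (norm_nonneg _).trans (hP n₀ d₀ hd₀)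
  -- The default `0` at bad indices keeps the chosen sequence bounded.
  have hch : ∀ n, ∃ d, ((∃ d, P n d) → P n d) ∧ ‖d‖ ≤ R + ‖x‖ := fun n => by
    by_cases h : ∃ d, P n d
    · obtain ⟨d, hd⟩ := h
      exact ⟨d, fun _ => hd, hP n d hd⟩
    · exact ⟨0, fun h' => absurd h' h, by simpa using hR⟩
  choose d hd hdR using hch
  let D : ℕ →ᵇ X := BoundedContinuousFunction.ofNormedAddCommGroupDiscrete d _ hdR
  have hk' : Tendsto (fun n => k n - 1) (hyperfilter ℕ : Filter ℕ) atTop :=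
    (tendsto_sub_atTop_nat 1).comp hk
  exact ⟨Submodule.Quotient.mk D,
    ge_of_tendsto (tendsto_norm_ultrapower D) (hev.mono fun n hn => (hd n hn).1),
    ⟨_, x + D, hk', hev.mono fun n hn => (hd n hn).2.1, rfl⟩,
    ⟨_, x - D, hk', hev.mono fun n hn => (hd n hn).2.2, rfl⟩⟩

/-- A set all of whose points are midpoints of `ε`-separated pairs has a countable nonempty
subset with the same property. -/
theorem exists_countable_midpoints {Y : Type u} [NormedAddCommGroup Y] {ε : ℝ} {T : Set Y}
    (hne : T.Nonempty) (h : ∀ t ∈ T, ∃ d, ε ≤ ‖d‖ ∧ t + d ∈ T ∧ t - d ∈ T) :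
    ∃ S ⊆ T, S.Countable ∧ S.Nonempty ∧ ∀ t ∈ S, ∃ d, ε ≤ ‖d‖ ∧ t + d ∈ S ∧ t - d ∈ S := by
  choose! d hd hp hm using h
  obtain ⟨t₀, ht₀⟩ := hne
  let f : List Bool → Y := List.foldr (fun b t => if b then t + d t else t - d t) t₀
  have hf : ∀ l, f l ∈ T := by
    intro l
    induction l with
    | nil => exact ht₀
    | cons b l ih =>
      change (if b then f l + d (f l) else f l - d (f l)) ∈ T
      cases b
      · simpa using hm _ ih
      · simpa using hp _ ih
  refine ⟨range f, range_subset_iff.2 hf, countable_range f, ⟨t₀, [], rfl⟩, ?_⟩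
  rintro _ ⟨l, rfl⟩
  exact ⟨d (f l), hd _ (hf l), ⟨true :: l, by simp [f]⟩, ⟨false :: l, by simp [f]⟩⟩

/-- A super-reflexive space does not have the finite tree property. -/
theorem exists_not_hasTree [CompleteSpace X] (hX : SuperReflexive X) {ε : ℝ} (hε : 0 < ε)
    (R : ℝ) : ∃ n, ∀ x : X, ¬ HasTree ε R n x := by
  by_contra! h
  obtain ⟨S, hST, hSc, hSne, hS⟩ := exists_countable_midpoints (treePoints_nonempty h)
    fun y hy => exists_midpoint_of_mem_treePoints hy
  exact not_isReflexiveSpace_of_midpoints hSc hSne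
    (fun t ht => norm_le_of_mem_treePoints (hST ht)) hε hS
    (hX (Ultrapower X) finitelyRepresentable_ultrapower)

end Tree

end Enflo

namespace Enflo

open Filter Topology Set

/-! ### Splittings into separated halves -/

section Part

/-- `DyadicPart ε m z r`: the vector `z` is split `m` times into `ε`-separated halves of equal
norm, and `r` is the sum of the norms of the resulting `2 ^ m` pieces. -/
inductive DyadicPart {X : Type u} [NormedAddCommGroup X] (ε : ℝ) : ℕ → X → ℝ → Prop
  | zero (z : X) : DyadicPart ε 0 z ‖z‖
  | succ {m : ℕ} {x y : X} {r s : ℝ} (hxy : ‖x‖ = ‖y‖) (hsep : ε * ‖x‖ ≤ ‖x - y‖)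
      (hx : DyadicPart ε m x r) (hy : DyadicPart ε m y s) : DyadicPart ε (m + 1) (x + y) (r + s)

theorem DyadicPart.norm_le {X : Type u} [NormedAddCommGroup X] {ε : ℝ} {m : ℕ} {z : X} {r : ℝ}
    (h : DyadicPart ε m z r) : ‖z‖ ≤ r := by
  induction h with
  | zero z => exact le_rfl
  | succ _ _ _ _ h1 h2 => exact (norm_add_le _ _).trans (add_le_add h1 h2)

/-- Undoing the last splittings cannot increase the sum, by the triangle inequality. -/
theorem DyadicPart.exists_pred {X : Type u} [NormedAddCommGroup X] {ε : ℝ} {m : ℕ} {z : X}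
    {r : ℝ} (h : DyadicPart ε (m + 1) z r) : ∃ r' ≤ r, DyadicPart ε m z r' := by
  induction m generalizing z r with
  | zero => exact ⟨_, h.norm_le, .zero z⟩
  | succ m ih =>
    cases h with
    | succ hxy hsep h1 h2 =>
      obtain ⟨r₁, hr₁, h1'⟩ := ih h1
      obtain ⟨r₂, hr₂, h2'⟩ := ih h2
      exact ⟨_, add_le_add hr₁ hr₂, .succ hxy hsep h1' h2'⟩

theorem DyadicPart.exists_of_le {X : Type u} [NormedAddCommGroup X] {ε : ℝ} {m k : ℕ}
    (hmk : m ≤ k) {z : X} {r : ℝ}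
    (h : DyadicPart ε k z r) : ∃ r' ≤ r, DyadicPart ε m z r' := by
  induction k, hmk using Nat.le_induction generalizing r with
  | base => exact ⟨r, le_rfl, h⟩
  | succ k _ ih =>
    obtain ⟨r₁, hr₁, h1⟩ := h.exists_pred
    obtain ⟨r₂, hr₂, h2⟩ := ih h1
    exact ⟨r₂, hr₂.trans hr₁, h2⟩

variable {X : Type u} [NormedAddCommGroup X] [NormedSpace ℝ X] {ε : ℝ}

theorem DyadicPart.smul {m : ℕ} {z : X} {r : ℝ} (h : DyadicPart ε m z r) (c : ℝ) :
    DyadicPart ε m (c • z) (|c| * r) := by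
  induction h with
  | zero z =>
    rw [← Real.norm_eq_abs, ← norm_smul]
    exact .zero _
  | succ hxy hsep _ _ h1 h2 =>
    rw [smul_add, mul_add]
    refine .succ (by rw [norm_smul, norm_smul, hxy]) ?_ h1 h2
    rw [← smul_sub, norm_smul, norm_smul]
    nlinarith [norm_nonneg c]

/-- A splitting that hardly increases the norm gives a separated tree. -/
theorem DyadicPart.hasTree (hε : 0 ≤ ε) {R : ℝ} {m : ℕ} {z : X} {r η : ℝ}
    (h : DyadicPart ε m z r) (hη : 0 ≤ η) (hr : r ≤ ‖z‖ + η) (hz : 1 ≤ ‖z‖)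
    (hR : ‖z‖ + (2 ^ m - 1) * η ≤ R) : HasTree (ε / 2) R m z := by
  induction m generalizing z r η with
  | zero => simpa [HasTree] using hR
  | succ m ih =>
    have h2m : (1 : ℝ) ≤ 2 ^ m := one_le_pow₀ (by norm_num)
    have h0 : 0 ≤ (2 ^ m - 1) * η := mul_nonneg (by linarith) hη
    rw [pow_succ] at hR
    cases h with
    | @succ _ x y r s hxy hsep h1 h2 =>
      have hz2 : ‖x + y‖ ≤ ‖x‖ + ‖y‖ := norm_add_le x y
      have hxr := h1.norm_le
      have hys := h2.norm_le
      -- The children of `x + y` are `2 • x` and `2 • y`. Doubling also doubles the admissible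
      -- excess `η`, which the term `(2 ^ m - 1) * η` absorbs.
      have key : ∀ w : X, ∀ q, DyadicPart ε m w q → ‖w‖ = ‖x‖ → q ≤ ‖x‖ + η →
          HasTree (ε / 2) R m ((2 : ℝ) • w) := by
        intro w q hw hwx hq
        have hw2 : ‖(2 : ℝ) • w‖ = 2 * ‖x‖ := by rw [norm_smul, hwx]; norm_num
        refine ih (η := 2 * η) (hw.smul 2) (by linarith) ?_ ?_ ?_
        · rw [hw2, abs_of_pos two_pos]; linarith
        · rw [hw2]; linarith
        · rw [hw2]; linarith
      refine ⟨by linarith, x - y, by nlinarith, ?_, ?_⟩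
      · have : x + y + (x - y) = (2 : ℝ) • x := by module
        rw [this]
        exact key x r h1 rfl (by linarith)
      · have : x + y - (x - y) = (2 : ℝ) • y := by module
        rw [this]
        exact key y s h2 hxy.symm (by linarith)

/-- In a super-reflexive space, splitting often enough increases the norm by a fixed factor. -/
theorem exists_le_of_dyadicPart [CompleteSpace X] (hX : SuperReflexive X) (hε : 0 < ε) :
    ∃ (n : ℕ) (δ : ℝ), 0 < δ ∧ δ ≤ 1 ∧
      ∀ (z : X) (r : ℝ), DyadicPart ε n z r → (1 + δ) * ‖z‖ ≤ r := by
  obtain ⟨n, hn⟩ := exists_not_hasTree hX (half_pos hε) 2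
  refine ⟨n, (2 ^ n)⁻¹, by positivity, inv_le_one_of_one_le₀ (one_le_pow₀ (by norm_num)),
    fun z r h => ?_⟩
  by_contra! hlt
  rcases eq_or_ne z 0 with rfl | hz
  · simpa using h.norm_le.trans_lt hlt
  have hz0 : 0 < ‖z‖ := norm_pos_iff.2 hz
  have h1 : ‖‖z‖⁻¹ • z‖ = 1 := by
    rw [norm_smul, norm_inv, norm_norm, inv_mul_cancel₀ hz0.ne']
  have h2 : (2 ^ n - 1) * ((2 : ℝ) ^ n)⁻¹ ≤ 1 := by
    rw [sub_mul, mul_inv_cancel₀ (by positivity)]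
    linarith [show 0 < 1 * ((2 : ℝ) ^ n)⁻¹ by positivity]
  refine hn _ ((h.smul ‖z‖⁻¹).hasTree hε.le (η := (2 ^ n)⁻¹) (by positivity) ?_ h1.ge
    (by rw [h1]; linarith))
  rw [h1, abs_of_pos (by positivity), inv_mul_le_iff₀ hz0, mul_comm]
  exact hlt.le

end Part

/-! ### The discounted norm and its convexity at one scale -/

section Renorming

variable {X : Type u} [NormedAddCommGroup X] [NormedSpace ℝ X]

/-- The increasing weights by which the `m`-fold splittings are discounted. -/
noncomputable def weight (δ : ℝ) (m : ℕ) : ℝ := 1 + δ * (1 - (1 / 4) ^ m)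

theorem one_le_weight {δ : ℝ} (hδ : 0 < δ) (m : ℕ) : 1 ≤ weight δ m := by
  have : (1 / 4 : ℝ) ^ m ≤ 1 := pow_le_one₀ (by norm_num) (by norm_num)
  have := mul_nonneg hδ.le (sub_nonneg.2 this)
  rw [weight]; linarith

theorem weight_lt {δ : ℝ} (hδ : 0 < δ) (m : ℕ) : weight δ m < 1 + δ := by
  have := mul_pos hδ (show 0 < (1 / 4 : ℝ) ^ m by positivity)
  rw [weight]; linarith

/-- The vectors whose norm, discounted along some splitting, is less than one. -/
def discountedBall (X : Type u) [NormedAddCommGroup X] [NormedSpace ℝ X] (ε δ : ℝ) : Set X :=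
  {z | ∃ m r, DyadicPart ε m z r ∧ r < weight δ m ∧ r ≤ weight δ m * ‖z‖}

variable {ε δ : ℝ}

theorem ball_subset_discountedBall : Metric.ball (0 : X) 1 ⊆ discountedBall X ε δ := by
  intro z hz
  exact ⟨0, ‖z‖, .zero z, by simpa [weight] using hz, by simp [weight]⟩

theorem discountedBall_subset_ball (hδ : 0 < δ) (hδ1 : δ ≤ 1) :
    discountedBall X ε δ ⊆ Metric.ball (0 : X) 2 := by
  rintro z ⟨m, r, h, hr, -⟩
  rw [mem_ball_zero_iff]
  linarith [h.norm_le, weight_lt hδ m]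

theorem balanced_discountedBall : Balanced ℝ (discountedBall X ε δ) := by
  rw [balanced_iff_smul_mem]
  rintro c hc z ⟨m, r, h, hr, hrz⟩
  have hr0 : 0 ≤ r := (norm_nonneg z).trans h.norm_le
  rw [Real.norm_eq_abs] at hc
  refine ⟨m, |c| * r, h.smul c, by nlinarith [abs_nonneg c], ?_⟩
  rw [norm_smul, Real.norm_eq_abs]
  nlinarith [mul_le_mul_of_nonneg_left hrz (abs_nonneg c)]

theorem absorbent_convexHull_discountedBall :
    Absorbent ℝ (convexHull ℝ (discountedBall X ε δ)) :=
  (absorbent_nhds_zero (Metric.ball_mem_nhds (0 : X) one_pos)).mono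
    (ball_subset_discountedBall.trans (subset_convexHull ℝ _))

/-- The norm whose unit ball is the convex hull of the discounted ball. -/
noncomputable def discountedNorm (X : Type u) [NormedAddCommGroup X] [NormedSpace ℝ X]
    (ε δ : ℝ) : Seminorm ℝ X :=
  gaugeSeminorm (𝕜 := ℝ) (balanced_discountedBall (X := X) (ε := ε) (δ := δ)).convexHull
    (convex_convexHull ℝ _) absorbent_convexHull_discountedBall

theorem discountedNorm_le_norm (x : X) : discountedNorm X ε δ x ≤ ‖x‖ := by
  rw [← gauge_unit_ball x]
  exact gauge_mono (absorbent_nhds_zero (Metric.ball_mem_nhds (0 : X) one_pos))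
    (ball_subset_discountedBall.trans (subset_convexHull ℝ _)) x

theorem half_norm_le_discountedNorm (hδ : 0 < δ) (hδ1 : δ ≤ 1) (x : X) :
    ‖x‖ / 2 ≤ discountedNorm X ε δ x := by
  rw [← gauge_ball two_pos.le]
  exact gauge_mono absorbent_convexHull_discountedBall
    (convexHull_min (discountedBall_subset_ball hδ hδ1) (convex_ball _ _)) x

theorem discountedNorm_le_one_of_mem {x : X} (hx : x ∈ convexHull ℝ (discountedBall X ε δ)) :
    discountedNorm X ε δ x ≤ 1 :=
  gauge_le_one_of_mem hx

theorem mem_convexHull_of_discountedNorm_lt_one {x : X} (hx : discountedNorm X ε δ x < 1) :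
    x ∈ convexHull ℝ (discountedBall X ε δ) :=
  setOfPred_gauge_lt_one_subset_self (convex_convexHull ℝ _)
    (subset_convexHull ℝ _ (ball_subset_discountedBall (by simp)))
    absorbent_convexHull_discountedBall hx

theorem DyadicPart.discountedNorm_le (hδ : 0 < δ) {m : ℕ} {z : X} {r : ℝ}
    (h : DyadicPart ε m z r) : discountedNorm X ε δ z ≤ r / weight δ m := by
  have hw := one_le_weight hδ m
  have hw0 : 0 < weight δ m := by linarith
  have hr0 : 0 ≤ r := (norm_nonneg z).trans h.norm_le
  -- A splitting excluded by the last condition of `discountedBall` gives a bound no better than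
  -- `‖z‖`.
  rcases le_total (weight δ m * ‖z‖) r with hle | hle
  · refine (discountedNorm_le_norm z).trans ?_
    rw [le_div_iff₀ hw0]; linarith
  refine le_of_forall_gt_imp_ge_of_dense fun a ha => ?_
  have ha0 : 0 < a := (div_nonneg hr0 hw0.le).trans_lt ha
  have hmem : a⁻¹ • z ∈ discountedBall X ε δ := by
    refine ⟨m, _, h.smul a⁻¹, ?_, ?_⟩
    · rw [abs_of_pos (by positivity), inv_mul_lt_iff₀ ha0]
      rwa [div_lt_iff₀ hw0] at ha
    · rw [norm_smul, Real.norm_eq_abs]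
      nlinarith [mul_le_mul_of_nonneg_left hle (abs_nonneg a⁻¹)]
  have h1 := discountedNorm_le_one_of_mem (subset_convexHull ℝ _ hmem)
  rw [map_smul_eq_mul, Real.norm_of_nonneg (by positivity), inv_mul_le_iff₀ ha0] at h1
  linarith

/-- At depth `n` or more the sum is at least `(1 + δ) * ‖z‖`, which no weight can offset. Bounded
depth keeps the gain `(1 / 4) ^ m` away from zero. -/
theorem DyadicPart.lt_of_le_weight_mul {X : Type u} [NormedAddCommGroup X] {ε δ : ℝ}
    (hδ : 0 < δ) {n : ℕ}
    (H : ∀ (z : X) (r : ℝ), DyadicPart ε n z r → (1 + δ) * ‖z‖ ≤ r)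
    {m : ℕ} {z : X} {r : ℝ} (h : DyadicPart ε m z r) (hr : r ≤ weight δ m * ‖z‖)
    (hz : 0 < ‖z‖) : m < n := by
  by_contra! hnm
  obtain ⟨r', hr', h'⟩ := h.exists_of_le hnm
  nlinarith [H z r' h', weight_lt hδ m]

/-- Joining two separated vectors of equal norm gains a fixed amount. -/
theorem discountedNorm_add_le_of_le (hδ : 0 < δ) (hδ1 : δ ≤ 1) {n : ℕ}
    (H : ∀ (z : X) (r : ℝ), DyadicPart ε n z r → (1 + δ) * ‖z‖ ≤ r)
    {x y : X} {m k : ℕ} {r s : ℝ} (hx : DyadicPart ε m x r) (hy : DyadicPart ε k y s)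
    (hr : r ≤ weight δ m * ‖x‖) (hs : s ≤ weight δ k * ‖y‖) (hxy : ‖x‖ = ‖y‖)
    (hsep : ε * ‖x‖ ≤ ‖x - y‖) (hx0 : 0 < ‖x‖) (hmk : m ≤ k) :
    discountedNorm X ε δ (x + y) ≤
      r / weight δ m + s / weight δ k - δ * (1 / 4) ^ n / 16 * ‖x‖ := by
  have hmn := hx.lt_of_le_weight_mul hδ H hr hx0
  -- The deeper splitting is cut to depth `m`, so that the two join to one of depth `m + 1`.
  obtain ⟨s', hs', hy'⟩ := hy.exists_of_le hmk
  refine ((DyadicPart.succ hxy hsep hx hy').discountedNorm_le hδ).trans ?_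
  have hm0 : 0 < weight δ m := by linarith [one_le_weight hδ m]
  have hk0 : 0 < weight δ k := by linarith [one_le_weight hδ k]
  have hm1 := one_le_weight hδ (m + 1)
  have hm2 := weight_lt hδ (m + 1)
  obtain ⟨u, hu⟩ : ∃ u, u = r / weight δ m := ⟨_, rfl⟩
  obtain ⟨v, hv⟩ : ∃ v, v = s / weight δ k := ⟨_, rfl⟩
  have hur : r = weight δ m * u := by rw [hu]; field_simp
  have hvs : s = weight δ k * v := by rw [hv]; field_simp
  have hv1 : v ≤ ‖x‖ := by
    rw [hvs, ← hxy] at hs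
    exact le_of_mul_le_mul_left hs hk0
  have hu1 : ‖x‖ / 2 ≤ u := by
    have := hx.norm_le
    rw [hu, div_le_div_iff₀ two_pos hm0]
    nlinarith [weight_lt hδ m]
  have hv0 : 0 ≤ v := by rw [hv]; exact div_nonneg ((norm_nonneg _).trans hy.norm_le) hk0.le
  rw [← hu, ← hv, div_le_iff₀ (by linarith)]
  set q : ℝ := (1 / 4) ^ m with hq
  have hq0 : 0 < q := by positivity
  -- In units of `δ * q * ‖x‖`, raising `m` to `m + 1` gains at least `3/4 * 1/2`, cutting `k` down
  -- loses at most `1/4`, and the remaining `1/8` covers the claimed gain times a weight below `2`.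
  have hw1 : weight δ (m + 1) - weight δ m = 3 / 4 * (δ * q) := by
    simp only [weight, pow_succ]; ring
  have hw2 : weight δ k - weight δ (m + 1) ≤ 1 / 4 * (δ * q) := by
    have : 0 < δ * (1 / 4) ^ k := by positivity
    simp only [weight, pow_succ]; linarith
  have hnq : (1 / 4 : ℝ) ^ n ≤ q := pow_le_pow_of_le_one (by norm_num) (by norm_num) hmn.le
  have hγ : δ * (1 / 4) ^ n / 16 * ‖x‖ ≤ δ * q / 16 * ‖x‖ := by gcongr
  have hγ0 : 0 ≤ δ * (1 / 4) ^ n / 16 * ‖x‖ := by positivity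
  have hdq : 0 < δ * q := by positivity
  have e1 : (weight δ k - weight δ (m + 1)) * v ≤ 1 / 4 * (δ * q) * ‖x‖ := by
    refine (mul_le_mul_of_nonneg_right hw2 hv0).trans ?_
    exact mul_le_mul_of_nonneg_left hv1 (by positivity)
  have e2 : 3 / 4 * (δ * q) * (‖x‖ / 2) ≤ (weight δ (m + 1) - weight δ m) * u := by
    rw [hw1]
    exact mul_le_mul_of_nonneg_left hu1 (by positivity)
  have e3 : δ * (1 / 4) ^ n / 16 * ‖x‖ * weight δ (m + 1) ≤ δ * q / 16 * ‖x‖ * 2 := by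
    refine mul_le_mul hγ (by linarith) (by linarith) (by positivity)
  nlinarith

theorem discountedNorm_add_le (hδ : 0 < δ) (hδ1 : δ ≤ 1) {n : ℕ}
    (H : ∀ (z : X) (r : ℝ), DyadicPart ε n z r → (1 + δ) * ‖z‖ ≤ r)
    {x y : X} {m k : ℕ} {r s : ℝ} (hx : DyadicPart ε m x r) (hy : DyadicPart ε k y s)
    (hr : r ≤ weight δ m * ‖x‖) (hs : s ≤ weight δ k * ‖y‖) (hxy : ‖x‖ = ‖y‖)
    (hsep : ε * ‖x‖ ≤ ‖x - y‖) (hx0 : 0 < ‖x‖) :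
    discountedNorm X ε δ (x + y) ≤
      r / weight δ m + s / weight δ k - δ * (1 / 4) ^ n / 16 * ‖x‖ := by
  rcases le_total m k with hmk | hmk
  · exact discountedNorm_add_le_of_le hδ hδ1 H hx hy hr hs hxy hsep hx0 hmk
  · have := discountedNorm_add_le_of_le hδ hδ1 H hy hx hs hr hxy.symm
      (by rwa [← hxy, norm_sub_rev]) (by rwa [← hxy]) hmk
    rw [add_comm y x, ← hxy] at this
    linarith

/-- Shrink `a` to the norm of `b`. If the result is separated from `b`, joining gains. Otherwise `a
- b` is almost radial, which forces `l ≤ 1 - 5 * ε` and hence `N b ≤ 1 - 3 * ε`. A tiny `b` is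
trivial. -/
theorem discountedNorm_add_le_of_mem_of_norm_le (hε : 0 < ε) (hδ : 0 < δ) (hδ1 : δ ≤ 1) {n : ℕ}
    (H : ∀ (z : X) (r : ℝ), DyadicPart ε n z r → (1 + δ) * ‖z‖ ≤ r) {a b : X}
    (ha : a ∈ discountedBall X ε δ) (hb : b ∈ discountedBall X ε δ)
    (hab : 12 * ε ≤ ‖a - b‖) (hba : ‖b‖ ≤ ‖a‖) :
    discountedNorm X ε δ (a + b) ≤ 2 - min (δ * (1 / 4) ^ n / 160) (3 * ε) := by
  have ha1 := discountedNorm_le_one_of_mem (subset_convexHull ℝ _ ha)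
  have ha2 := mem_ball_zero_iff.1 (discountedBall_subset_ball hδ hδ1 ha)
  have hb2 := mem_ball_zero_iff.1 (discountedBall_subset_ball hδ hδ1 hb)
  set N := discountedNorm X ε δ with hN
  have hγ1 : δ * (1 / 4) ^ n ≤ 1 :=
    mul_le_one₀ hδ1 (by positivity) (pow_le_one₀ (by norm_num) (by norm_num))
  rcases lt_or_ge ‖b‖ (1 / 10) with hsmall | hlarge
  · have h1 := map_add_le_add N a b
    have h2 : N b ≤ ‖b‖ := discountedNorm_le_norm b
    linarith [min_le_left (δ * (1 / 4) ^ n / 160) (3 * ε)]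
  obtain ⟨m, r, hpa, hr1, hr⟩ := ha
  obtain ⟨k, s, hpb, hs1, hs⟩ := hb
  have ha0 : 0 < ‖a‖ := by linarith
  obtain ⟨l, hl⟩ : ∃ l, l = ‖b‖ / ‖a‖ := ⟨_, rfl⟩
  have hla : l * ‖a‖ = ‖b‖ := by rw [hl]; field_simp
  have hl0 : 0 ≤ l := by rw [hl]; positivity
  have hl1 : l ≤ 1 := by rw [hl, div_le_one ha0]; exact hba
  have hnorm : ‖l • a‖ = ‖b‖ := by rw [norm_smul, Real.norm_of_nonneg hl0, hla]
  rcases le_or_gt (ε * ‖l • a‖) ‖l • a - b‖ with hsep | hclose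
  · have h1 := discountedNorm_add_le hδ hδ1 H (hpa.smul l) hpb
      (by rw [hnorm, abs_of_nonneg hl0, ← hla]; nlinarith) hs hnorm hsep (by linarith)
    have h2 : N a ≤ r / weight δ m := hpa.discountedNorm_le hδ
    have hm0 : 0 < weight δ m := by linarith [one_le_weight hδ m]
    have hk0 : 0 < weight δ k := by linarith [one_le_weight hδ k]
    have h3 : r / weight δ m ≤ 1 := (div_le_one hm0).2 hr1.le
    have h4 : s / weight δ k ≤ 1 := (div_le_one hk0).2 hs1.le
    have h5 : N (a + b) ≤ N (l • a + b) + (1 - l) * N a := by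
      have : a + b = (l • a + b) + (1 - l) • a := by module
      rw [this]
      refine (map_add_le_add N _ _).trans_eq ?_
      rw [map_smul_eq_mul N, Real.norm_of_nonneg (by linarith : (0:ℝ) ≤ 1 - l)]
    have h6 : (1 - l) * N a ≤ (1 - l) * (r / weight δ m) :=
      mul_le_mul_of_nonneg_left h2 (by linarith)
    rw [abs_of_nonneg hl0, mul_div_assoc, hnorm, ← hN] at h1
    have h7 : δ * (1 / 4) ^ n / 16 * (1 / 10) ≤ δ * (1 / 4) ^ n / 16 * ‖b‖ := by gcongr
    linarith [min_le_left (δ * (1 / 4) ^ n / 160) (3 * ε)]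
  · have h1 : ‖l • a - b‖ ≤ 2 * ε := by rw [hnorm] at hclose; nlinarith
    have h2 : N b ≤ l + 2 * ε := by
      have : b = l • a - (l • a - b) := by module
      have h3 : N b ≤ N (l • a) + N (l • a - b) := by
        conv_lhs => rw [this]
        exact map_sub_le_add N _ _
      rw [map_smul_eq_mul, Real.norm_of_nonneg hl0] at h3
      have h4 : N (l • a - b) ≤ ‖l • a - b‖ := discountedNorm_le_norm _
      nlinarith
    have h5 : ‖a - b‖ ≤ 2 * (1 - l) + 2 * ε := by
      have : a - b = (1 - l) • a + (l • a - b) := by module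
      rw [this]
      refine (norm_add_le _ _).trans ?_
      rw [norm_smul, Real.norm_of_nonneg (by linarith : (0:ℝ) ≤ 1 - l)]
      nlinarith
    linarith [map_add_le_add N a b, min_le_right (δ * (1 / 4) ^ n / 160) (3 * ε)]

theorem discountedNorm_add_le_of_mem (hε : 0 < ε) (hδ : 0 < δ) (hδ1 : δ ≤ 1) {n : ℕ}
    (H : ∀ (z : X) (r : ℝ), DyadicPart ε n z r → (1 + δ) * ‖z‖ ≤ r) {a b : X}
    (ha : a ∈ discountedBall X ε δ) (hb : b ∈ discountedBall X ε δ) (hab : 12 * ε ≤ ‖a - b‖) :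
    discountedNorm X ε δ (a + b) ≤ 2 - min (δ * (1 / 4) ^ n / 160) (3 * ε) := by
  rcases le_total ‖b‖ ‖a‖ with h | h
  · exact discountedNorm_add_le_of_mem_of_norm_le hε hδ hδ1 H ha hb hab h
  · rw [add_comm]
    exact discountedNorm_add_le_of_mem_of_norm_le hε hδ hδ1 H hb ha (by rwa [norm_sub_rev]) h

/-- A jointly convex bound for a seminorm passes from two sets to their convex hulls. -/
theorem add_mul_norm_sub_le_of_mem_convexHull (p : Seminorm ℝ X) {κ M : ℝ} (hκ : 0 ≤ κ)
    {S : Set X} (h : ∀ a ∈ S, ∀ b ∈ S, p (a + b) + κ * ‖a - b‖ ≤ M) {x y : X}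
    (hx : x ∈ convexHull ℝ S) (hy : y ∈ convexHull ℝ S) : p (x + y) + κ * ‖x - y‖ ≤ M := by
  have hconv : ∀ c : X, Convex ℝ {z : X | p (z + c) + κ * ‖z - c‖ ≤ M} := by
    intro c
    have h1 : ConvexOn ℝ univ fun z : X => p (z + c) := by
      simpa [Function.comp_def] using p.convexOn.translate_left c
    have h2 : ConvexOn ℝ univ fun z : X => κ * ‖z - c‖ := by
      have := (convexOn_univ_dist (c : X)).smul hκ
      simpa [dist_eq_norm] using this
    simpa using (h1.add h2).convex_le M
  have hxb : ∀ b ∈ S, p (x + b) + κ * ‖x - b‖ ≤ M := fun b hb =>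
    convexHull_min (fun a ha => h a ha b hb) (hconv b) hx
  have := convexHull_min (fun b hb => show b ∈ {z : X | p (z + x) + κ * ‖z - x‖ ≤ M} by
    rw [mem_ofPred_eq, add_comm b, norm_sub_rev]; exact hxb b hb) (hconv x) hy
  rwa [mem_ofPred_eq, add_comm y, norm_sub_rev] at this

/-- For each `ε` a super-reflexive space has an equivalent norm that is uniformly convex as far
as vectors at distance at least `ε` are concerned. -/
theorem exists_seminorm_uniformConvex_at [CompleteSpace X] (hX : SuperReflexive X)
    {e : ℝ} (he : 0 < e) :
    ∃ p : Seminorm ℝ X, (∀ x, ‖x‖ / 2 ≤ p x ∧ p x ≤ ‖x‖) ∧ ∃ η : ℝ, 0 < η ∧ ∀ x y : X,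
      p x = 1 → p y = 1 → e ≤ ‖x - y‖ → p (x + y) ≤ 2 - η := by
  have hε : 0 < e / 24 := by positivity
  obtain ⟨ε, hεe⟩ : ∃ ε, ε = e / 24 := ⟨_, rfl⟩
  rw [← hεe] at hε
  obtain ⟨n, δ, hδ, hδ1, H⟩ := exists_le_of_dyadicPart hX hε
  obtain ⟨η, hη⟩ : ∃ η, η = min (δ * (1 / 4) ^ n / 160) (3 * ε) := ⟨_, rfl⟩
  have hη0 : 0 < η := by rw [hη]; exact lt_min (by positivity) (by positivity)
  refine ⟨discountedNorm X ε δ, fun x => ⟨half_norm_le_discountedNorm hδ hδ1 x,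
    discountedNorm_le_norm x⟩, η / 4 * (12 * ε), by positivity, fun x y hx hy hxy => ?_⟩
  -- Since `‖a - b‖ < 4`, the penalty with factor `η / 4` never exceeds the gain `η` of separated
  -- pairs; for close pairs it is at most `η / 4 * (12 * ε)`. Separation `e = 24 * ε` in the hull
  -- beats that.
  have hball : ∀ a ∈ discountedBall X ε δ, ∀ b ∈ discountedBall X ε δ,
      discountedNorm X ε δ (a + b) + η / 4 * ‖a - b‖ ≤ 2 + η / 4 * (12 * ε) := by
    intro a ha b hb
    have ha1 := discountedNorm_le_one_of_mem (subset_convexHull ℝ _ ha)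
    have hb1 := discountedNorm_le_one_of_mem (subset_convexHull ℝ _ hb)
    have ha2 := mem_ball_zero_iff.1 (discountedBall_subset_ball hδ hδ1 ha)
    have hb2 := mem_ball_zero_iff.1 (discountedBall_subset_ball hδ hδ1 hb)
    rcases le_total (12 * ε) ‖a - b‖ with h | h
    · have h1 := discountedNorm_add_le_of_mem hε hδ hδ1 H ha hb h
      rw [← hη] at h1
      have h2 := norm_sub_le a b
      have h3 : 0 < η / 4 * (12 * ε) := by positivity
      nlinarith
    · have h1 := map_add_le_add (discountedNorm X ε δ) a b
      nlinarith
  -- Vectors of norm exactly one may lie outside the hull, so they are scaled by `θ < 1` and `θ`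
  -- tends to `1`.
  have hθ : ∀ θ ∈ Ioo (0 : ℝ) 1, θ * (discountedNorm X ε δ (x + y) + η / 4 * ‖x - y‖) ≤
      2 + η / 4 * (12 * ε) := by
    rintro θ ⟨h0, h1⟩
    have hmem : ∀ z : X, discountedNorm X ε δ z = 1 →
        θ • z ∈ convexHull ℝ (discountedBall X ε δ) := fun z hz =>
      mem_convexHull_of_discountedNorm_lt_one
        (by rwa [map_smul_eq_mul, hz, Real.norm_of_nonneg h0.le, mul_one])
    have := add_mul_norm_sub_le_of_mem_convexHull _ (by positivity) hball (hmem x hx) (hmem y hy)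
    rw [← smul_add, ← smul_sub, map_smul_eq_mul, norm_smul, Real.norm_of_nonneg h0.le] at this
    linarith
  have hlim : discountedNorm X ε δ (x + y) + η / 4 * ‖x - y‖ ≤ 2 + η / 4 * (12 * ε) := by
    have ht : Tendsto (fun θ : ℝ => θ * (discountedNorm X ε δ (x + y) + η / 4 * ‖x - y‖))
        (𝓝[<] 1) (𝓝 (1 * (discountedNorm X ε δ (x + y) + η / 4 * ‖x - y‖))) :=
      ((continuous_id.mul continuous_const).tendsto 1).mono_left nhdsWithin_le_nhds
    rw [one_mul] at ht
    exact le_of_tendsto ht (eventually_of_mem (Ioo_mem_nhdsLT zero_lt_one) hθ)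
  have : η / 4 * (24 * ε) ≤ η / 4 * ‖x - y‖ := by
    apply mul_le_mul_of_nonneg_left _ (by positivity)
    linarith
  linarith

/-! ### Combining all scales by a geometric series -/

theorem summable_geometricSum {p : ℕ → Seminorm ℝ X} (hp : ∀ k x, p k x ≤ ‖x‖) (x : X) :
    Summable fun k => (1 / 2) ^ (k + 1) * p k x :=
  Summable.of_nonneg_of_le (fun k => mul_nonneg (by positivity) (apply_nonneg (p k) x))
    (fun k => mul_le_mul_of_nonneg_left (hp k x) (by positivity))
    (((summable_nat_add_iff 1).2 summable_geometric_two).mul_right ‖x‖)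

/-- The sum of a sequence of seminorms dominated by the norm, with geometric weights. -/
noncomputable def geometricSum (p : ℕ → Seminorm ℝ X) (hp : ∀ k x, p k x ≤ ‖x‖) :
    Seminorm ℝ X :=
  have hs := summable_geometricSum hp
  Seminorm.of (fun x => ∑' k, (1 / 2) ^ (k + 1) * p k x)
    (fun x y => by
      rw [← (hs x).tsum_add (hs y)]
      refine (hs _).tsum_le_tsum (fun k => ?_) ((hs x).add (hs y))
      rw [← mul_add]
      exact mul_le_mul_of_nonneg_left (map_add_le_add (p k) x y) (by positivity))
    (fun c x => by
      rw [← tsum_mul_left]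
      congr 1 with k
      rw [map_smul_eq_mul]; ring)

theorem tsum_geometric_mul (c : ℝ) : ∑' k : ℕ, (1 / 2 : ℝ) ^ (k + 1) * c = c := by
  rw [tsum_mul_right]
  simp_rw [pow_succ]
  rw [tsum_mul_right, tsum_geometric_two]
  ring

theorem geometricSum_le_norm {p : ℕ → Seminorm ℝ X} (hp : ∀ k x, p k x ≤ ‖x‖) (x : X) :
    geometricSum p hp x ≤ ‖x‖ := by
  conv_rhs => rw [← tsum_geometric_mul ‖x‖]
  exact (summable_geometricSum hp x).tsum_le_tsum
    (fun k => mul_le_mul_of_nonneg_left (hp k x) (by positivity))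
    (((summable_nat_add_iff 1).2 summable_geometric_two).mul_right ‖x‖)

theorem half_norm_le_geometricSum {p : ℕ → Seminorm ℝ X} (hp : ∀ k x, p k x ≤ ‖x‖)
    (hp' : ∀ k x, ‖x‖ / 2 ≤ p k x) (x : X) : ‖x‖ / 2 ≤ geometricSum p hp x := by
  rw [← tsum_geometric_mul (‖x‖ / 2)]
  exact Summable.tsum_le_tsum (fun k => mul_le_mul_of_nonneg_left (hp' k x) (by positivity))
    (((summable_nat_add_iff 1).2 summable_geometric_two).mul_right _)
    (summable_geometricSum hp x)

/-- A gain in one of the summands is a gain in the sum. -/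
theorem geometricSum_add_le {p : ℕ → Seminorm ℝ X} (hp : ∀ k x, p k x ≤ ‖x‖) {x y : X} {k : ℕ}
    {η : ℝ} (h : p k (x + y) ≤ p k x + p k y - η) :
    geometricSum p hp (x + y) ≤
      geometricSum p hp x + geometricSum p hp y - (1 / 2) ^ (k + 1) * η := by
  have hs := ((summable_geometricSum hp x).add (summable_geometricSum hp y)).sub
    (summable_geometricSum hp (x + y))
  have h1 : (1 / 2) ^ (k + 1) * η ≤ ∑' j, ((1 / 2) ^ (j + 1) * p j x + (1 / 2) ^ (j + 1) * p j y
      - (1 / 2) ^ (j + 1) * p j (x + y)) := by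
    refine le_trans ?_ (hs.le_tsum k fun j _ => ?_)
    · rw [← mul_add, ← mul_sub]
      exact mul_le_mul_of_nonneg_left (by linarith) (by positivity)
    · rw [← mul_add, ← mul_sub]
      exact mul_nonneg (by positivity) (sub_nonneg.2 (map_add_le_add (p j) x y))
  rw [((summable_geometricSum hp x).add (summable_geometricSum hp y)).tsum_sub
    (summable_geometricSum hp (x + y)), (summable_geometricSum hp x).tsum_add
    (summable_geometricSum hp y)] at h1
  change geometricSum p hp (x + y) ≤ _
  have e : ∀ z, geometricSum p hp z = ∑' j, (1 / 2) ^ (j + 1) * p j z := fun z => rfl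
  rw [← e, ← e, ← e] at h1
  linarith

/-- Uniform convexity on the unit sphere, for vectors of arbitrary size at least `1 / 2`. -/
theorem seminorm_add_le_of_separated (p : Seminorm ℝ X) {e η : ℝ}
    (h : ∀ x y : X, p x = 1 → p y = 1 → e ≤ ‖x - y‖ → p (x + y) ≤ 2 - η) {x y : X}
    (hx : 1 / 2 ≤ p x) (hy : 1 / 2 ≤ p y) (hxy : e ≤ ‖(p x)⁻¹ • x - (p y)⁻¹ • y‖) :
    p (x + y) ≤ p x + p y - η / 2 := by
  have hx0 : 0 < p x := by linarith
  have hy0 : 0 < p y := by linarith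
  have hu : p ((p x)⁻¹ • x) = 1 := by
    rw [map_smul_eq_mul, Real.norm_of_nonneg (by positivity), inv_mul_cancel₀ hx0.ne']
  have hv : p ((p y)⁻¹ • y) = 1 := by
    rw [map_smul_eq_mul, Real.norm_of_nonneg (by positivity), inv_mul_cancel₀ hy0.ne']
  have h1 := h _ _ hu hv hxy
  set u := (p x)⁻¹ • x with hu'
  set v := (p y)⁻¹ • y with hv'
  have e1 : x = p x • u := by rw [hu', smul_inv_smul₀ hx0.ne']
  have e2 : y = p y • v := by rw [hv', smul_inv_smul₀ hy0.ne']
  -- Only the common portion `1 / 2` of `u` and `v` uses convexity; the rest is the triangle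
  -- inequality.
  have e3 : x + y = (1 / 2 : ℝ) • (u + v) + ((p x - 1 / 2) • u + (p y - 1 / 2) • v) := by
    conv_lhs => rw [e1, e2]
    module
  rw [e3]
  refine (map_add_le_add p _ _).trans ?_
  have h2 := map_add_le_add p ((p x - 1 / 2) • u) ((p y - 1 / 2) • v)
  rw [map_smul_eq_mul p (p x - 1 / 2) u, map_smul_eq_mul p (p y - 1 / 2) v, hu, hv,
    Real.norm_of_nonneg (by linarith),
    Real.norm_of_nonneg (by linarith)] at h2
  rw [map_smul_eq_mul, Real.norm_of_nonneg (by norm_num)]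
  linarith

end Renorming

end Enflo


open Enflo in
theorem theorem7p1 (X : Type u) [NormedAddCommGroup X] [NormedSpace ℝ X] [CompleteSpace X]
    (hX : SuperReflexive X) :
    ∃ p : Seminorm ℝ X, IsEquivalentNorm p ∧ IsUniformlyConvexNorm p := by
  choose p hp η hη hconv using fun k : ℕ =>
    exists_seminorm_uniformConvex_at hX (show (0 : ℝ) < 1 / (k + 1) by positivity)
  have hpu : ∀ k x, p k x ≤ ‖x‖ := fun k x => (hp k x).2
  have hqu := geometricSum_le_norm hpu
  have hql := half_norm_le_geometricSum hpu fun k x => (hp k x).1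
  set q := geometricSum p hpu with hq
  refine ⟨q, ⟨1 / 2, 1, by norm_num, one_pos, fun x => ⟨by linarith [hql x], by
    linarith [hqu x]⟩⟩, (isUniformlyConvexNorm_iff q).2 fun ε hε => ?_⟩
  -- If the normalised vectors were closer than `1 / (k + 1)`, then `x` would be within `2 / (k +
  -- 1)` of `c • y`. Since `q x = q y = 1`, also `|1 - c| ≤ 2 / (k + 1)`, and `‖y‖ ≤ 2` gives `‖x -
  -- y‖ ≤ 6 / (k + 1) < ε`.
  obtain ⟨k, hk⟩ := exists_nat_one_div_lt (show 0 < ε / 6 by positivity)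
  refine ⟨(1 / 2) ^ (k + 1) * (η k / 2), mul_pos (by positivity) (half_pos (hη k)),
    fun x y hx hy hxy => ?_⟩
  have hx1 : 1 ≤ ‖x‖ := hx ▸ hqu x
  have hy1 : 1 ≤ ‖y‖ := hy ▸ hqu y
  have hx2 : ‖x‖ ≤ 2 := by linarith [hql x]
  have hy2 : ‖y‖ ≤ 2 := by linarith [hql y]
  have hsx : 1 / 2 ≤ p k x := by linarith [(hp k x).1]
  have hsy : 1 / 2 ≤ p k y := by linarith [(hp k y).1]
  have hx0 : 0 < p k x := by linarith
  have hsep : 1 / ((k : ℝ) + 1) ≤ ‖(p k x)⁻¹ • x - (p k y)⁻¹ • y‖ := by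
    by_contra! hlt
    obtain ⟨c, hc⟩ : ∃ c, c = p k x * (p k y)⁻¹ := ⟨_, rfl⟩
    have h1 : x - c • y = p k x • ((p k x)⁻¹ • x - (p k y)⁻¹ • y) := by
      rw [smul_sub, smul_inv_smul₀ hx0.ne', smul_smul, hc]
    have h2 : ‖x - c • y‖ ≤ 2 * (1 / ((k : ℝ) + 1)) := by
      rw [h1, norm_smul, Real.norm_of_nonneg hx0.le]
      exact mul_le_mul ((hpu k x).trans hx2) hlt.le (norm_nonneg _) two_pos.le
    have hc0 : 0 ≤ c := by rw [hc]; positivity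
    have hcy : q (c • y) = c := by rw [map_smul_eq_mul, hy, Real.norm_of_nonneg hc0, mul_one]
    have h3 : |1 - c| ≤ ‖x - c • y‖ := by
      have := abs_sub_map_le_sub q x (c • y)
      rw [hx, hcy] at this
      exact this.trans (hqu _)
    have h4 : ‖x - y‖ ≤ ‖x - c • y‖ + |1 - c| * ‖y‖ := by
      have : x - y = (x - c • y) - (1 - c) • y := by module
      rw [this, ← Real.norm_eq_abs, ← norm_smul]
      exact norm_sub_le _ _
    have h5 := hqu (x - y)
    nlinarith [abs_nonneg (1 - c)]
  have := geometricSum_add_le hpu (seminorm_add_le_of_separated (p k) (hconv k) hsx hsy hsep)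
  rw [← hq, hx, hy] at this
  linarith
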